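/- Let $n\ge 1$, let $a,b,c,d\in\mathbb{R}$ with $ad-bc\neq 0$, and let $\gamma_1,\dots,\gamma_n>0$ have geometric mean $\bar\gamma=\sqrt[n]{\gamma_1\cdots\gamma_n}$. For $\gamma>0$ put $$\Delta_\gamma=\Big\{\tfrac{\gamma(az+b)}{cz+d}\in\mathbb{C}\cup\{\infty\} : z\in\mathbb{C},\ |z|\le 1\Big\}.$$ Suppose that the inequality $$(b^2-a^2)\bar\gamma^2+2\beta(ac-bd)\bar\gamma+d^2-c^2>0$$ holds both for $\beta=\cos(\pi/n)$ and for $\beta=\cos\big(\pi(2\lceil n/2\rceil-1)/n\big)$. Let $M_k,N_k\in\mathbb{R}[s]$, $k=1,\dots,n$, be such that, for every $k$ and every $s\in\mathbb{C}$ with $\operatorname{Re}s\ge 0$, $N_k(s)$ and $M_k(s)$ are not both zero and $N_k(s)/M_k(s)\in\Delta_{\gamma_k}$ (with $N_k(s)/M_k(s)=\infty$ if $M_k(s)=0$). Then the cyclic interconnection $$M_k\big(\tfrac{\mathrm d}{\mathrm dt}\big)y_k=N_k\big(\tfrac{\mathrm d}{\mathrm dt}\big)u_k\ (k=1,\dots,n),\qquad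 u=Sy,\qquad S=\begin{bmatrix}0&-1\\ I_{n-1}&0\end{bmatrix},$$ that is, the system $$\begin{bmatrix}\operatorname{diag}(N_1(\tfrac{\mathrm d}{\mathrm dt}),\dots,N_n(\tfrac{\mathrm d}{\mathrm dt}))&\operatorname{diag}(M_1(\tfrac{\mathrm d}{\mathrm dt}),\dots,M_n(\tfrac{\mathrm d}{\mathrm dt}))\\ I_n&S\end{bmatrix}\begin{bmatrix}u\\-y\end{bmatrix}=0,$$ is asymptotically stable: every weak solution $w=(u,-y)$ (a locally integrable function $w:\mathbb{R}\to\mathbb{R}^{2n}$ that satisfies the equations in the sense of distributions) satisfies $\lim_{t\to\infty}w(t)=0$, where the limit is understood up to modification of $w$ on a set of measure zero. -/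

import Mathlib

open Polynomial Filter Topology MeasureTheory
open scoped ContDiff

namespace CyclicFeedback

noncomputable section

/-- A locally integrable `w : ℝ → ℝ^κ` is a weak solution of the system of linear
differential equations `R(d/dt) w = 0` if `R(d/dt) w = 0` in the sense of distributions:
for each row `i` and each test function `φ`,
`∑ j, ∑ m, r_{ijm} (-1)^m ∫ φ^(m)(t) w_j(t) dt = 0`, where `R_{ij}(s) = ∑ m, r_{ijm} s^m`. -/
def IsWeakSolution {ι κ : Type*} [Fintype κ] (R : Matrix ι κ ℝ[X]) (w : ℝ → κ → ℝ) : Prop :=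
  LocallyIntegrable w volume ∧
    ∀ φ : ℝ → ℝ, ContDiff ℝ ∞ φ → HasCompactSupport φ → ∀ i : ι,
      ∑ j : κ, (R i j).sum (fun m r => r * ((-1) ^ m * ∫ t : ℝ, iteratedDeriv m φ t * w t j)) = 0

/-- The dynamics `R(d/dt) w = 0` are asymptotically stable if every weak solution satisfies
`w(t) → 0` as `t → ∞`. Weak solutions are only determined up to a null set, so the limit is
the essential one: for each neighbourhood `U` of `0` there is a `T` such that `w t ∈ U` for
almost every `t ≥ T`. -/
def AsymptoticallyStable {ι κ : Type*} [Fintype κ] (R : Matrix ι κ ℝ[X]) : Prop :=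
  ∀ w : ℝ → κ → ℝ, IsWeakSolution R w → Tendsto w (atTop ⊓ ae volume) (𝓝 0)

/-- The `n × n` matrix `S = [0, -1; I_{n-1}, 0]` (for `n = 1`, `S = [-1]`). -/
def cyclicMatrix (A : Type*) [Ring A] (n : ℕ) : Matrix (Fin n) (Fin n) A :=
  Matrix.of fun i j =>
    if (i : ℕ) = 0 ∧ (j : ℕ) + 1 = n then -1
    else if (i : ℕ) = (j : ℕ) + 1 then 1
    else 0

/-- The polynomial matrix `[diag N, diag M; I, S]`, acting on the signals `(u, -y)`: its
kernel describes `M_k(d/dt) y_k = N_k(d/dt) u_k` for all `k`, together with `u = S y`. -/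
def interconnection {n : ℕ} (N M : Fin n → ℝ[X]) :
    Matrix (Fin n ⊕ Fin n) (Fin n ⊕ Fin n) ℝ[X] :=
  Matrix.fromBlocks (Matrix.diagonal N) (Matrix.diagonal M) 1 (cyclicMatrix ℝ[X] n)

/-- The quotient `x / y` as a point of the extended complex plane, with `x / 0 = ∞`.
It is only meaningful if `x` and `y` are not both zero. -/
def extQuot (x y : ℂ) : OnePoint ℂ :=
  if y = 0 then OnePoint.infty else ((x / y : ℂ) : OnePoint ℂ)

/-- The image of the closed unit disk under `z ↦ γ (a z + b) / (c z + d)`, in the extended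
complex plane. -/
def mobiusDisk (a b c d γ : ℝ) : Set (OnePoint ℂ) :=
  {w | ∃ z : ℂ, ‖z‖ ≤ 1 ∧ w = extQuot (γ * (a * z + b)) (c * z + d)}

/-- The geometric mean of `γ_1, …, γ_n`. -/
def geomMean {n : ℕ} (γ : Fin n → ℝ) : ℝ := (∏ k, γ k) ^ (1 / (n : ℝ))

/-- The inequality `(b² - a²) g² + 2 β (a c - b d) g + d² - c² > 0`. -/
def SecantInequality (a b c d g β : ℝ) : Prop :=
  0 < (b ^ 2 - a ^ 2) * g ^ 2 + 2 * β * (a * c - b * d) * g + d ^ 2 - c ^ 2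

end

end CyclicFeedback

namespace CyclicFeedback

/-! The proof has an algebraic half and an analytic half, joined by the determinant of the
interconnection.

Algebraic half: suppose that determinant vanishes at some `s` with `Re s ≥ 0`. A kernel vector gives
`u = S y` with `N_k(s) u_k = M_k(s) y_k`, and the disk condition becomes `|d y_k - γ_k b u_k| ≤ |γ_k
a u_k - c y_k|`. A diagonal rescaling replaces every `γ_k` by the geometric mean `g`. Summing the
squared inequalities gives `A ∑ |z_k|² + B q(z) ≤ 0`, where `q` is the form of the negative feedback
cycle. The values of `q` on unit vectors lie between the two cosines of the hypotheses
(`cyclic_form_le`, `le_cyclic_form`). Since `A + B β` is affine in `β` and positive at both ends, `z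
= 0`, a contradiction.

Analytic half: multiplying by the adjugate shows that each component of a weak solution is
annihilated by the determinant (`comp_aeval_det_eq_zero`). Its complex roots lie in the open left
half plane, so it can be inverted one linear factor at a time, each step adding a decaying
exponential to a convolution that tends to `0` (`exists_continuous_tendsto_zero_of_roots`).
Distributions enter only as linear functionals; their continuity is not needed. -/

/-! ### Extreme values of the cyclic quadratic form -/

/-- Lower bound for the quadratic form of a path with fixed end points. -/
theorem path_form_lower_bound (x : ℕ → ℝ) {θ : ℝ} (hθ : 0 < θ) (m : ℕ)
    (hm : ((m : ℝ) + 1) * θ < Real.pi) :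
    ((x 0 ^ 2 + x (m + 1) ^ 2) * Real.cos ((m + 1) * θ) - 2 * x 0 * x (m + 1)) * Real.sin θ ≤
      Real.sin ((m + 1) * θ) *
        ∑ k ∈ Finset.range (m + 1),
          ((x k ^ 2 + x (k + 1) ^ 2) * Real.cos θ - 2 * x k * x (k + 1)) := by
  induction m with
  | zero => simp; linarith
  | succ m ih =>
    push_cast at hm ⊢
    have hm' : ((m : ℝ) + 1) * θ < Real.pi := by linarith
    have ih := ih hm'
    rw [Finset.sum_range_succ]
    set Q := ∑ k ∈ Finset.range (m + 1),
          ((x k ^ 2 + x (k + 1) ^ 2) * Real.cos θ - 2 * x k * x (k + 1))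
    have hs : 0 < Real.sin ((m + 1) * θ) :=
      Real.sin_pos_of_pos_of_lt_pi (by positivity) hm'
    have hs' : 0 < Real.sin ((m + 1 + 1) * θ) :=
      Real.sin_pos_of_pos_of_lt_pi (by positivity) hm
    have e : ((m : ℝ) + 1 + 1) * θ = (m + 1) * θ + θ := by ring
    rw [e] at hs' ⊢
    set α := ((m : ℝ) + 1) * θ
    have hS := Real.sin_add α θ
    have hC := Real.cos_add α θ
    set S := Real.sin (α + θ)
    have h1 := Real.sin_sq_add_cos_sq α
    have h2 := Real.sin_sq_add_cos_sq θ
    rw [hC]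
    set s := Real.sin α
    set c := Real.cos α
    set p := Real.sin θ
    set q := Real.cos θ
    -- Completing the square in the vertex `x (m + 1)`, which becomes interior when the path is
    -- extended.
    have key : s * (S * (Q + ((x (m + 1) ^ 2 + x (m + 1 + 1) ^ 2) * q
          - 2 * x (m + 1) * x (m + 1 + 1)))
        - ((x 0 ^ 2 + x (m + 1 + 1) ^ 2) * (c * q - s * p) - 2 * x 0 * x (m + 1 + 1)) * p) =
        S * (s * Q - ((x 0 ^ 2 + x (m + 1) ^ 2) * c - 2 * x 0 * x (m + 1)) * p) +
        (S * x (m + 1) - (x 0 * p + x (m + 1 + 1) * s)) ^ 2 := by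
      rw [hS]
      linear_combination (x 0 ^ 2 * p ^ 2 ) * h1 + (x (m+1+1) ^ 2 * s ^ 2) * h2
    have h3 : 0 ≤ s * Q - ((x 0 ^ 2 + x (m + 1) ^ 2) * c - 2 * x 0 * x (m + 1)) * p := by linarith
    have h4 := mul_nonneg hs'.le h3
    have h5 := sq_nonneg (S * x (m + 1) - (x 0 * p + x (m + 1 + 1) * s))
    rw [← sub_nonneg, ← mul_nonneg_iff_of_pos_left hs, key]
    exact add_nonneg h4 h5

/-- The numerical range of the matrix of a negative feedback cycle lies to the left of
`cos (π / n)`. -/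
theorem cyclic_form_le (m : ℕ) (x : ℕ → ℝ) :
    ∑ k ∈ Finset.range m, x k * x (k + 1) - x 0 * x m ≤
      Real.cos (Real.pi / (m + 1 : ℕ)) * ∑ k ∈ Finset.range (m + 1), x k ^ 2 := by
  rcases m with _ | m
  · simp; nlinarith
  -- With this angle `(m + 1) θ = π - θ`: the sines in the path bound cancel and the cosine changes
  -- sign, which closes the path with a negative edge.
  set θ := Real.pi / (m + 1 + 1 : ℕ) with hθd
  have hθ : 0 < θ := by positivity
  have hπ : ((m : ℝ) + 1) * θ = Real.pi - θ := by
    rw [hθd]; push_cast; field_simp; ring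
  have h := path_form_lower_bound x hθ m (by linarith)
  rw [hπ, Real.sin_pi_sub, Real.cos_pi_sub] at h
  have hp : 0 < Real.sin θ := by
    apply Real.sin_pos_of_pos_of_lt_pi hθ
    have : 0 < ((m : ℝ) + 1) * θ := by positivity
    linarith
  rw [mul_comm (Real.sin θ)] at h
  have h := le_of_mul_le_mul_right h hp
  have e1 := Finset.sum_range_succ (fun k => x k ^ 2) (m + 1)
  have e2 := Finset.sum_range_succ' (fun k => x k ^ 2) (m + 1)
  simp only [Finset.sum_sub_distrib, ← Finset.sum_mul, Finset.sum_add_distrib, mul_assoc,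
    ← Finset.mul_sum] at h
  linear_combination (1 / 2) * h + Real.cos θ / 2 * (- e1 - e2)

theorem cos_ceil_half_of_even {m : ℕ} (hm : Even m) :
    Real.cos (Real.pi * (2 * (⌈((m + 1 : ℕ) : ℝ) / 2⌉ : ℝ) - 1) / (m + 1 : ℕ)) = -1 := by
  obtain ⟨r, rfl⟩ := hm
  have : ⌈((r + r + 1 : ℕ) : ℝ) / 2⌉ = (r : ℤ) + 1 := by
    rw [Int.ceil_eq_iff]
    push_cast
    constructor <;> linarith
  rw [this, ← Real.cos_pi]
  congr 1
  push_cast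
  field_simp
  ring

theorem cos_ceil_half_of_odd {m : ℕ} (hm : Odd m) :
    Real.cos (Real.pi * (2 * (⌈((m + 1 : ℕ) : ℝ) / 2⌉ : ℝ) - 1) / (m + 1 : ℕ)) =
      -Real.cos (Real.pi / (m + 1 : ℕ)) := by
  obtain ⟨r, rfl⟩ := hm
  have : ⌈((2 * r + 1 + 1 : ℕ) : ℝ) / 2⌉ = (r : ℤ) + 1 := by
    rw [Int.ceil_eq_iff]
    push_cast
    constructor <;> linarith
  rw [this, ← Real.cos_pi_sub]
  congr 1
  push_cast
  field_simp
  ring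

/-- The numerical range of the matrix of a negative feedback cycle is bounded from the left. -/
theorem le_cyclic_form (m : ℕ) (x : ℕ → ℝ) :
    Real.cos (Real.pi * (2 * (⌈((m + 1 : ℕ) : ℝ) / 2⌉ : ℝ) - 1) / (m + 1 : ℕ)) *
        ∑ k ∈ Finset.range (m + 1), x k ^ 2 ≤
      ∑ k ∈ Finset.range m, x k * x (k + 1) - x 0 * x m := by
  rcases Nat.even_or_odd m with hm | hm
  · rw [cos_ceil_half_of_even hm]
    have e1 := Finset.sum_range_succ (fun k => x k ^ 2) m
    have e2 := Finset.sum_range_succ' (fun k => x k ^ 2) m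
    have h : ∑ k ∈ Finset.range m, (x k ^ 2 + x (k + 1) ^ 2) ≥
        ∑ k ∈ Finset.range m, (-2) * (x k * x (k + 1)) :=
      Finset.sum_le_sum fun k _ => by nlinarith [sq_nonneg (x k + x (k + 1))]
    rw [Finset.sum_add_distrib, ← Finset.mul_sum] at h
    nlinarith [sq_nonneg (x 0 - x m)]
  · rw [cos_ceil_half_of_odd hm]
    -- For an even number of vertices, alternating signs negate the form, including its closing
    -- edge.
    have h := cyclic_form_le m (fun k => (-1) ^ k * x k)
    have e1 : ∀ k, ((-1) ^ k * x k) * ((-1) ^ (k + 1) * x (k + 1)) = -(x k * x (k + 1)) := by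
      intro k
      have : ((-1 : ℝ) ^ k) * (-1) ^ k = 1 := by rw [← mul_pow]; simp
      linear_combination (-(x k * x (k + 1))) * this
    have e2 : ∀ k, ((-1) ^ k * x k) ^ 2 = x k ^ 2 := by
      intro k
      rw [mul_pow, ← pow_mul, mul_comm k 2, pow_mul]; simp
    simp only [e1, e2, Finset.sum_neg_distrib, hm.neg_one_pow] at h
    linarith

/-- Both extreme values of the cosine being admissible makes the form of the cycle definite. -/
theorem eq_zero_of_cyclic_form_nonpos (m : ℕ) (y : ℕ → ℂ) (A B : ℝ)
    (h1 : 0 < A + B * Real.cos (Real.pi / (m + 1 : ℕ)))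
    (h2 : 0 < A + B *
      Real.cos (Real.pi * (2 * (⌈((m + 1 : ℕ) : ℝ) / 2⌉ : ℝ) - 1) / (m + 1 : ℕ)))
    (h : A * ∑ k ∈ Finset.range (m + 1), ‖y k‖ ^ 2 +
      B * (∑ k ∈ Finset.range m, (y k * star (y (k + 1))).re - (y 0 * star (y m)).re) ≤ 0) :
    ∀ k ≤ m, y k = 0 := by
  have e : ∑ k ∈ Finset.range (m + 1), ‖y k‖ ^ 2 =
      ∑ k ∈ Finset.range (m + 1), (y k).re ^ 2 + ∑ k ∈ Finset.range (m + 1), (y k).im ^ 2 := by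
    rw [← Finset.sum_add_distrib]
    exact Finset.sum_congr rfl fun k _ => by rw [Complex.sq_norm, Complex.normSq_apply]; ring
  have e' : ∀ z w : ℂ, (z * star w).re = z.re * w.re + z.im * w.im := fun z w => by simp
  simp only [e', Finset.sum_add_distrib] at h
  have a1 := cyclic_form_le m fun k => (y k).re
  have a2 := cyclic_form_le m fun k => (y k).im
  have b1 := le_cyclic_form m fun k => (y k).re
  have b2 := le_cyclic_form m fun k => (y k).im
  have hpos : 0 ≤ ∑ k ∈ Finset.range (m + 1), ‖y k‖ ^ 2 :=
    Finset.sum_nonneg fun k _ => sq_nonneg _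
  have hz : ∑ k ∈ Finset.range (m + 1), ‖y k‖ ^ 2 = 0 := by
    set Y := ∑ k ∈ Finset.range (m + 1), ‖y k‖ ^ 2
    by_contra hne
    have hY : 0 < Y := lt_of_le_of_ne hpos (Ne.symm hne)
    -- The sign of `B` decides which end of the range is the worst case.
    rcases le_total 0 B with hB | hB
    · have c := mul_le_mul_of_nonneg_left (add_le_add b1 b2) hB
      rw [← mul_add, ← e] at c
      nlinarith [mul_pos h2 hY]
    · have c := mul_le_mul_of_nonpos_left (add_le_add a1 a2) hB
      rw [← mul_add, ← e] at c
      nlinarith [mul_pos h1 hY]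
  intro k hk
  rw [Finset.sum_eq_zero_iff_of_nonneg fun k _ => sq_nonneg _] at hz
  simpa using hz k (by simp; omega)

/-! ### From disks to a nonvanishing determinant -/

/-- Cross-multiplying gives `γ (a z + b) u = (c z + d) y`, also at the point `∞`; solving for `z`
turns `|z| ≤ 1` into the bound. -/
theorem norm_le_of_extQuot_mem_mobiusDisk {a b c d γ : ℝ} {N M u y : ℂ} (h0 : N ≠ 0 ∨ M ≠ 0)
    (h : extQuot N M ∈ mobiusDisk a b c d γ) (huy : N * u = M * y) :
    ‖d * y - γ * b * u‖ ≤ ‖γ * a * u - c * y‖ := by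
  obtain ⟨z, hz, hw⟩ := h
  have key : (γ * (a * z + b)) * u = (c * z + d) * y := by
    unfold extQuot at hw
    by_cases hM : M = 0
    · by_cases hq : (c : ℂ) * z + d = 0
      · have hN : N ≠ 0 := h0.resolve_right (not_not.2 hM)
        have hu : u = 0 := by simpa [hM, hN] using huy
        simp [hu, hq]
      · simp [hM, hq] at hw
    · by_cases hq : (c : ℂ) * z + d = 0
      · simp [hM, hq] at hw
      · rw [if_neg hM, if_neg hq, OnePoint.coe_eq_coe, div_eq_div_iff hM hq] at hw
        apply mul_left_cancel₀ hM
        linear_combination (c * z + d) * huy - u * hw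
  have e : d * y - γ * b * u = z * (γ * a * u - c * y) := by linear_combination -key
  rw [e, norm_mul]
  exact mul_le_of_le_one_left (norm_nonneg _) hz

theorem quadratic_form_nonpos {a b c d g : ℝ} {v z : ℂ}
    (h : ‖d * z - g * b * v‖ ≤ ‖g * a * v - c * z‖) :
    (d ^ 2 - c ^ 2) * ‖z‖ ^ 2 + (b ^ 2 - a ^ 2) * g ^ 2 * ‖v‖ ^ 2 +
      2 * (a * c - b * d) * g * (v * star z).re ≤ 0 := by
  have h := pow_le_pow_left₀ (norm_nonneg _) h 2
  simp only [Complex.sq_norm, Complex.normSq_apply] at h ⊢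
  simp at h ⊢
  linarith

theorem eq_zero_of_cyclic_sector_bound {a b c d g : ℝ} {m : ℕ} {γ : ℕ → ℝ} (hγ : ∀ k, 0 < γ k)
    (hg : 0 < g) (hprod : ∏ k ∈ Finset.range (m + 1), γ k = g ^ (m + 1))
    (h1 : SecantInequality a b c d g (Real.cos (Real.pi / (m + 1 : ℕ))))
    (h2 : SecantInequality a b c d g
      (Real.cos (Real.pi * (2 * (⌈((m + 1 : ℕ) : ℝ) / 2⌉ : ℝ) - 1) / (m + 1 : ℕ))))
    {u y : ℕ → ℂ} (hu : u 0 = -y m) (hus : ∀ k < m, u (k + 1) = y k)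
    (hb : ∀ k < m + 1, ‖d * y k - γ k * b * u k‖ ≤ ‖γ k * a * u k - c * y k‖) :
    ∀ k ≤ m, y k = 0 := by
  -- The normalised partial products equalise the gains along the chain; `τ m = 1` because `g` is
  -- the geometric mean, so the loop closes consistently.
  set τ : ℕ → ℝ := fun k => ∏ j ∈ Finset.range (k + 1), γ j / g with hτ
  have τpos : ∀ k, 0 < τ k := fun k => Finset.prod_pos fun j _ => div_pos (hγ j) hg
  have τm : τ m = 1 := by
    simp [hτ, Finset.prod_div_distrib, hprod, hg.ne']
  have τs : ∀ k, γ (k + 1) * τ k = τ (k + 1) * g := by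
    intro k
    have : τ (k + 1) = τ k * (γ (k + 1) / g) := Finset.prod_range_succ _ _
    rw [this]
    field_simp
  have τ0 : γ 0 = τ 0 * g := by simp [hτ, hg.ne']
  have τne : ∀ k, (τ k : ℂ) ≠ 0 := fun k => by exact_mod_cast (τpos k).ne'
  obtain ⟨z, hz⟩ : ∃ z : ℕ → ℂ, ∀ k, y k = τ k * z k :=
    ⟨fun k => y k / τ k, fun k => by field_simp [τne k]⟩
  have scale : ∀ k < m + 1, ∀ v : ℂ, γ k * u k = τ k * (g * v) →
      ‖d * z k - g * b * v‖ ≤ ‖g * a * v - c * z k‖ := by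
    intro k hk v hv
    have h := hb k hk
    have e1 : d * y k - γ k * b * u k = τ k * (d * z k - g * b * v) := by
      linear_combination (d : ℂ) * hz k - b * hv
    have e2 : γ k * a * u k - c * y k = τ k * (g * a * v - c * z k) := by
      linear_combination -(c : ℂ) * hz k + a * hv
    rw [e1, e2, norm_mul, norm_mul] at h
    exact le_of_mul_le_mul_left h (norm_pos_iff.2 (τne k))
  have q0 := quadratic_form_nonpos (scale 0 (by omega) (-z m) (by
    have : (γ 0 : ℂ) = τ 0 * g := by exact_mod_cast τ0
    rw [hu, hz m, τm, this]; push_cast; ring))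
  have qs : ∀ k ∈ Finset.range m, _ := fun k hk =>
    quadratic_form_nonpos (scale (k + 1) (by simp at hk; omega) (z k) (by
      have : (γ (k + 1) : ℂ) * τ k = τ (k + 1) * g := by exact_mod_cast τs k
      rw [hus k (by simpa using hk), hz k]; linear_combination z k * this))
  have q := Finset.sum_nonpos qs
  simp only [Finset.sum_add_distrib, ← Finset.mul_sum] at q
  have e1 := Finset.sum_range_succ (fun k => ‖z k‖ ^ 2) m
  have e2 := Finset.sum_range_succ' (fun k => ‖z k‖ ^ 2) m
  have e3 : (-z m * star (z 0)).re = -(z 0 * star (z m)).re := by simp; ring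
  rw [e3, norm_neg] at q0
  intro k hk
  rw [hz, eq_zero_of_cyclic_form_nonpos m z ((b ^ 2 - a ^ 2) * g ^ 2 + d ^ 2 - c ^ 2)
    (2 * (a * c - b * d) * g) (by unfold SecantInequality at h1; linarith)
    (by unfold SecantInequality at h2; linarith) _ k hk, mul_zero]
  linear_combination q + q0 + (d ^ 2 - c ^ 2) * e2 + (b ^ 2 - a ^ 2) * g ^ 2 * e1

theorem geomMean_pow {n : ℕ} (hn : n ≠ 0) {γ : Fin n → ℝ} (hγ : ∀ k, 0 < γ k) :
    geomMean γ ^ n = ∏ k, γ k := by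
  rw [geomMean, one_div, Real.rpow_inv_natCast_pow (Finset.prod_nonneg fun k _ => (hγ k).le) hn]

theorem cyclicMatrix_mulVec_zero {m : ℕ} (y : Fin (m + 1) → ℂ) :
    (cyclicMatrix ℂ (m + 1)).mulVec y 0 = -y (Fin.last m) := by
  rw [Matrix.mulVec, dotProduct, Finset.sum_eq_single (Fin.last m)]
  · simp [cyclicMatrix]
  · intro j _ hj
    have : (j : ℕ) ≠ m := fun h => hj (Fin.ext h)
    simp [cyclicMatrix, this]
  · simp

theorem cyclicMatrix_mulVec_succ {m : ℕ} (y : Fin (m + 1) → ℂ) (k : Fin m) :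
    (cyclicMatrix ℂ (m + 1)).mulVec y k.succ = y k.castSucc := by
  rw [Matrix.mulVec, dotProduct, Finset.sum_eq_single k.castSucc]
  · simp [cyclicMatrix]
  · intro j _ hj
    have : (k : ℕ) ≠ j := fun h => hj (Fin.ext h.symm)
    simp [cyclicMatrix, this]
  · simp

theorem map_cyclicMatrix {A B : Type*} [Ring A] [Ring B] (f : A →+* B) (n : ℕ) :
    (cyclicMatrix A n).map f = cyclicMatrix B n := by
  ext i j
  simp only [cyclicMatrix, Matrix.map_apply, Matrix.of_apply]
  split_ifs <;> simp

/-- The characteristic polynomial of the interconnection is Hurwitz. -/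
theorem aeval_det_interconnection_ne_zero {n : ℕ} (hn : 1 ≤ n) {a b c d : ℝ}
    {γ : Fin n → ℝ} (hγ : ∀ k, 0 < γ k)
    (h1 : SecantInequality a b c d (geomMean γ) (Real.cos (Real.pi / n)))
    (h2 : SecantInequality a b c d (geomMean γ)
      (Real.cos (Real.pi * (2 * (⌈(n : ℝ) / 2⌉ : ℝ) - 1) / n)))
    {M N : Fin n → ℝ[X]} {s : ℂ}
    (hMN : ∀ k, (aeval s (N k) ≠ 0 ∨ aeval s (M k) ≠ 0) ∧
      extQuot (aeval s (N k)) (aeval s (M k)) ∈ mobiusDisk a b c d (γ k)) :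
    aeval s (interconnection N M).det ≠ 0 := by
  obtain ⟨m, rfl⟩ : ∃ m, n = m + 1 := ⟨n - 1, by omega⟩
  intro hdet
  rw [AlgHom.map_det, ← Matrix.exists_mulVec_eq_zero_iff] at hdet
  obtain ⟨v, hv0, hv⟩ := hdet
  have hR : (aeval (R := ℝ) s).mapMatrix (interconnection N M) =
      Matrix.fromBlocks (Matrix.diagonal fun k => aeval s (N k))
        (Matrix.diagonal fun k => aeval s (M k)) 1 (cyclicMatrix ℂ (m + 1)) := by
    have := map_cyclicMatrix (aeval (R := ℝ) s).toRingHom (m + 1)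
    rw [AlgHom.mapMatrix_apply, interconnection, Matrix.fromBlocks_map, Matrix.diagonal_map,
      Matrix.diagonal_map, Matrix.map_one, ← this] <;> simp
  rw [hR, Matrix.fromBlocks_mulVec] at hv
  set u := v ∘ Sum.inl
  set y := -(v ∘ Sum.inr) with hy
  have hvr : v ∘ Sum.inr = -y := by rw [hy, neg_neg]
  have hrow : ∀ k, aeval s (N k) * u k = aeval s (M k) * y k := by
    intro k
    have := congrFun hv (Sum.inl k)
    rw [hvr] at this
    simp [Matrix.mulVec_diagonal] at this
    linear_combination this
  have hu : u = (cyclicMatrix ℂ (m + 1)).mulVec y := by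
    funext k
    have := congrFun hv (Sum.inr k)
    rw [hvr] at this
    simp [Matrix.mulVec_neg] at this
    linear_combination this
  have hcoe : ∀ k : Fin (m + 1), Fin.ofNat (m + 1) k = k := fun k => by simp
  have hy0 : ∀ k ≤ m, y (Fin.ofNat (m + 1) k) = 0 := by
    refine eq_zero_of_cyclic_sector_bound (a := a) (b := b) (c := c) (d := d)
      (γ := fun k => γ (Fin.ofNat (m + 1) k)) (g := geomMean γ)
      (u := fun k => u (Fin.ofNat (m + 1) k)) (fun k => hγ _)
      (Real.rpow_pos_of_pos (Finset.prod_pos fun k _ => hγ k) _) ?_ h1 h2 ?_ ?_ ?_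
    · rw [geomMean_pow (by omega) hγ, Finset.prod_range]
      exact Finset.prod_congr rfl fun k _ => by rw [hcoe]
    · have e0 : Fin.ofNat (m + 1) 0 = 0 := rfl
      have em : Fin.ofNat (m + 1) m = Fin.last m := hcoe (Fin.last m)
      simp only [e0, em]
      rw [hu, cyclicMatrix_mulVec_zero]
    · intro k hk
      have e0 : Fin.ofNat (m + 1) (k + 1) = (⟨k, hk⟩ : Fin m).succ := hcoe (⟨k, hk⟩ : Fin m).succ
      have em : Fin.ofNat (m + 1) k = (⟨k, hk⟩ : Fin m).castSucc := hcoe (⟨k, hk⟩ : Fin m).castSucc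
      simp only [e0, em]
      rw [hu, cyclicMatrix_mulVec_succ]
    · intro k _
      exact norm_le_of_extQuot_mem_mobiusDisk (hMN _).1 (hMN _).2 (hrow _)
  have hyz : y = 0 := funext fun k => by
    have := hy0 k (by omega)
    rwa [hcoe] at this
  rw [hyz, Matrix.mulVec_zero] at hu
  apply hv0
  funext k
  rcases k with k | k
  · exact congrFun hu k
  · simpa [hyz] using congrFun hvr k

/-! ### Test functions and distributions -/

/-- The complex valued test functions on the real line. -/
def testFunctions : Submodule ℂ (ℝ → ℂ) where
  carrier := {φ | ContDiff ℝ ∞ φ ∧ HasCompactSupport φ}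
  zero_mem' := ⟨contDiff_const, HasCompactSupport.zero⟩
  add_mem' h h' := ⟨h.1.add h'.1, h.2.add h'.2⟩
  smul_mem' c _ h := ⟨contDiff_const.smul h.1, h.2.smul_left (f := fun _ => c)⟩

theorem contDiff_testFunction (φ : testFunctions) : ContDiff ℝ ∞ φ.1 := φ.2.1

theorem hasCompactSupport_testFunction (φ : testFunctions) : HasCompactSupport φ.1 := φ.2.2

theorem differentiable_testFunction (φ : testFunctions) : Differentiable ℝ φ.1 :=
  (contDiff_testFunction φ).differentiable (by simp)

/-- The derivative of test functions. -/
noncomputable def testDeriv : Module.End ℂ testFunctions where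
  toFun φ := ⟨deriv φ, (contDiff_infty_iff_deriv.1 φ.2.1).2, φ.2.2.deriv⟩
  map_add' φ ψ := Subtype.ext <| funext fun t =>
    deriv_add (differentiable_testFunction φ t) (differentiable_testFunction ψ t)
  map_smul' c φ := Subtype.ext <| funext fun t =>
    deriv_const_smul c (differentiable_testFunction φ t)

@[simp] theorem coe_testDeriv (φ : testFunctions) : (testDeriv φ : ℝ → ℂ) = deriv φ := rfl

theorem coe_testDeriv_pow (m : ℕ) (φ : testFunctions) :
    ((testDeriv ^ m) φ : ℝ → ℂ) = iteratedDeriv m φ := by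
  induction m with
  | zero => simp
  | succ m ih => rw [pow_succ', Module.End.mul_apply, coe_testDeriv, ih, iteratedDeriv_succ]

theorem integrable_mul_testFunction {w : ℝ → ℂ} (hw : LocallyIntegrable w) (φ : testFunctions) :
    Integrable fun t => φ.1 t * w t :=
  hw.integrable_smul_left_of_hasCompactSupport (contDiff_testFunction φ).continuous
    (hasCompactSupport_testFunction φ)

/-- The distribution given by a locally integrable function. -/
noncomputable def toDistribution (w : ℝ → ℂ) (hw : LocallyIntegrable w) :
    testFunctions →ₗ[ℂ] ℂ where
  toFun φ := ∫ t, φ.1 t * w t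
  map_add' φ ψ := by
    rw [← integral_add (integrable_mul_testFunction hw φ) (integrable_mul_testFunction hw ψ)]
    exact integral_congr_ae (Eventually.of_forall fun t => add_mul _ _ _)
  map_smul' c φ := by
    rw [RingHom.id_apply, smul_eq_mul, ← integral_const_mul]
    exact integral_congr_ae (Eventually.of_forall fun t => mul_assoc _ _ _)

theorem toDistribution_apply {w : ℝ → ℂ} (hw : LocallyIntegrable w) (φ : testFunctions) :
    toDistribution w hw φ = ∫ t, φ.1 t * w t := rfl

/-- A real test function as a complex one. -/
def ofRealTest (φ : ℝ → ℝ) (h : ContDiff ℝ ∞ φ) (h' : HasCompactSupport φ) : testFunctions :=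
  ⟨fun t => (φ t : ℂ), Complex.ofRealCLM.contDiff.comp h, h'.comp_left Complex.ofReal_zero⟩

theorem eq_zero_of_ofRealTest {L : testFunctions →ₗ[ℂ] ℂ}
    (hL : ∀ φ h h', L (ofRealTest φ h h') = 0) : L = 0 := by
  ext φ
  obtain ⟨A, B, hA, hB, e⟩ : ∃ A B, L A = 0 ∧ L B = 0 ∧ φ = A + Complex.I • B :=
    ⟨_, _, hL (fun t => (φ.1 t).re) (Complex.reCLM.contDiff.comp (contDiff_testFunction φ))
        ((hasCompactSupport_testFunction φ).comp_left Complex.zero_re),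
      hL (fun t => (φ.1 t).im) (Complex.imCLM.contDiff.comp (contDiff_testFunction φ))
        ((hasCompactSupport_testFunction φ).comp_left Complex.zero_im), by
      ext t
      simp [ofRealTest, mul_comm Complex.I]⟩
  rw [e, map_add, map_smul, hA, hB]
  simp

theorem iteratedDeriv_ofReal {φ : ℝ → ℝ} (h : ContDiff ℝ ∞ φ) (m : ℕ) :
    iteratedDeriv m (fun t => (φ t : ℂ)) = fun t => ((iteratedDeriv m φ t : ℝ) : ℂ) := by
  induction m with
  | zero => simp
  | succ m ih =>
    rw [iteratedDeriv_succ, ih, iteratedDeriv_succ]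
    funext t
    have hd := h.differentiable_iteratedDeriv m (by exact_mod_cast ENat.natCast_lt_top m)
    exact (hd t).hasDerivAt.ofReal_comp.deriv

/-- The transpose of `d/dt` is `-testDeriv`, which accounts for the factors `(-1) ^ m` in the weak
formulation. -/
theorem toDistribution_aeval_ofRealTest {w : ℝ → ℝ} (hw : LocallyIntegrable fun t => (w t : ℂ))
    (p : ℝ[X]) (φ : ℝ → ℝ) (h : ContDiff ℝ ∞ φ) (h' : HasCompactSupport φ) :
    toDistribution _ hw (aeval (-testDeriv) p (ofRealTest φ h h')) =
      (p.sum fun m r => r * ((-1) ^ m * ∫ t, iteratedDeriv m φ t * w t) : ℝ) := by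
  rw [aeval_eq_sum_range, Polynomial.sum_over_range _ (by simp), LinearMap.sum_apply, map_sum,
    Complex.ofReal_sum]
  refine Finset.sum_congr rfl fun m _ => ?_
  have e : (p.coeff m • (-testDeriv) ^ m) (ofRealTest φ h h') =
      ((p.coeff m * (-1) ^ m : ℝ) : ℂ) • (testDeriv ^ m) (ofRealTest φ h h') := by
    rw [← neg_one_smul ℂ testDeriv, _root_.smul_pow]
    ext t
    simp [mul_assoc]
  rw [e, map_smul, toDistribution_apply, coe_testDeriv_pow]
  have : ∀ t, iteratedDeriv m ((ofRealTest φ h h') : ℝ → ℂ) t * (w t : ℂ) =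
      ((iteratedDeriv m φ t * w t : ℝ) : ℂ) := fun t => by
    rw [ofRealTest, iteratedDeriv_ofReal h]; push_cast; rfl
  simp only [this, integral_complex_ofReal, smul_eq_mul]
  push_cast
  ring

/-- A vector of distributions annihilated by a matrix of differential operators is annihilated,
componentwise, by the determinant. -/
theorem comp_aeval_det_eq_zero {κ : Type*} [Fintype κ] [DecidableEq κ] (R : Matrix κ κ ℝ[X])
    (D : Module.End ℂ testFunctions) (T : κ → testFunctions →ₗ[ℂ] ℂ)
    (hT : ∀ i, ∑ j, T j ∘ₗ aeval D (R i j) = 0) (k : κ) :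
    T k ∘ₗ aeval D R.det = 0 := by
  -- Precomposing row `i` with the entry `(k, i)` of the adjugate and summing leaves `R.adjugate * R
  -- = det • 1`, as scalar operators commute.
  have h : ∑ i, (∑ j, T j ∘ₗ aeval D (R i j)) ∘ₗ aeval D (R.adjugate k i) = 0 := by
    simp [hT]
  rw [← h]
  ext φ
  simp only [LinearMap.sum_apply, LinearMap.comp_apply]
  rw [Finset.sum_comm]
  have e : ∀ j, ∑ i, T j (aeval D (R i j) (aeval D (R.adjugate k i) φ)) =
      T j (aeval D ((R.adjugate * R) k j) φ) := by
    intro j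
    rw [Matrix.mul_apply, map_sum, LinearMap.sum_apply, map_sum]
    refine Finset.sum_congr rfl fun i _ => ?_
    rw [mul_comm, map_mul, Module.End.mul_apply]
  simp only [e, Matrix.adjugate_mul]
  rw [Finset.sum_eq_single k]
  · simp
  · intro j _ hj
    simp [Matrix.one_apply_ne hj.symm]
  · simp

/-! ### Scalar equations with stable roots -/

theorem continuous_cexp_mul (z : ℂ) : Continuous fun t : ℝ => Complex.exp (z * t) := by fun_prop

theorem hasDerivAt_cexp_mul (z : ℂ) (t : ℝ) :
    HasDerivAt (fun t : ℝ => Complex.exp (z * t)) (z * Complex.exp (z * t)) t := by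
  have h : HasDerivAt (fun t : ℝ => z * (t : ℂ)) z t := by
    simpa using (Complex.ofRealCLM.hasDerivAt (x := t)).const_mul z
  simpa [mul_comm] using h.cexp

theorem cexp_neg_mul_cexp (z : ℂ) (t : ℝ) :
    Complex.exp (-z * t) * Complex.exp (z * t) = 1 := by
  rw [← Complex.exp_add]; simp

theorem hasDerivAt_cexp_mul_integral {f : ℝ → ℂ} (hf : Continuous f) (z : ℂ) (a t : ℝ) :
    HasDerivAt (fun t : ℝ => Complex.exp (z * t) * ∫ s in a..t, Complex.exp (-z * s) * f s)
      (z * (Complex.exp (z * t) * ∫ s in a..t, Complex.exp (-z * s) * f s) + f t) t := by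
  have hc : Continuous fun s : ℝ => Complex.exp (-z * s) * f s :=
    (continuous_cexp_mul _).mul hf
  have h := (hasDerivAt_cexp_mul z t).mul
    (intervalIntegral.integral_hasDerivAt_right (hc.intervalIntegrable a t)
      (hc.stronglyMeasurableAtFilter _ _) hc.continuousAt)
  refine h.congr_deriv ?_
  linear_combination f t * cexp_neg_mul_cexp z t

/-- A first order differential operator maps onto the test functions orthogonal to the exponential
function in the kernel of its adjoint. -/
theorem exists_neg_deriv_sub_smul_eq {z : ℂ} {ψ : testFunctions}
    (h : ∫ t, ψ.1 t * Complex.exp (z * t) = 0) :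
    ∃ χ : testFunctions, (-testDeriv - algebraMap ℂ _ z) χ = ψ := by
  obtain ⟨r, hr, hψ⟩ := (hasCompactSupport_testFunction ψ).exists_pos_le_norm
  have hψc := (contDiff_testFunction ψ).continuous
  -- Variation of constants for `χ' = -z χ - ψ`, started to the left of the support of `ψ`.
  -- Orthogonality to the exponential makes `χ` vanish to the right as well.
  set χ : ℝ → ℂ := fun t =>
    Complex.exp (-z * t) * ∫ s in (-r)..t, Complex.exp (- -z * s) * -ψ.1 s
  have hd : ∀ t, HasDerivAt χ (-z * χ t + -ψ.1 t) t :=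
    hasDerivAt_cexp_mul_integral hψc.neg (-z) (-r)
  have hsm : ContDiff ℝ ∞ χ := by
    rw [contDiff_infty]
    intro m
    induction m with
    | zero => exact contDiff_zero.2 (continuous_iff_continuousAt.2 fun t => (hd t).continuousAt)
    | succ m ih =>
      push_cast
      rw [contDiff_succ_iff_deriv]
      refine ⟨fun t => (hd t).differentiableAt, by simp, ?_⟩
      rw [show deriv χ = fun t => -z * χ t + -ψ.1 t from funext fun t => (hd t).deriv]
      exact (contDiff_const.mul ih).add (contDiff_infty.1 (contDiff_testFunction ψ) m).neg
  have hsupp : HasCompactSupport χ := by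
    refine HasCompactSupport.intro (isCompact_Icc (a := -r) (b := r)) fun t ht => ?_
    simp only [Set.mem_Icc, not_and_or, not_le] at ht
    have : ∫ s in (-r)..t, Complex.exp (- -z * s) * -ψ.1 s = 0 := by
      rcases ht with ht | ht
      · refine (intervalIntegral.integral_congr (g := fun _ => 0) fun s hs => ?_).trans (by simp)
        rw [Set.uIcc_of_ge ht.le] at hs
        have : r ≤ ‖s‖ := by
          rw [Real.norm_eq_abs]; exact (le_neg.1 hs.2).trans (neg_le_abs s)
        simp [hψ s this]
      · rw [intervalIntegral.integral_eq_integral_of_support_subset]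
        · rw [← neg_eq_zero, ← integral_neg, ← h]
          exact integral_congr_ae (Eventually.of_forall fun s => by simp; ring)
        · intro s hs
          have : ¬ r ≤ ‖s‖ := fun h' => hs (by simp [hψ s h'])
          rw [Real.norm_eq_abs, not_le, abs_lt] at this
          exact ⟨this.1, (this.2.trans ht).le⟩
    simp only [χ, this, mul_zero]
  refine ⟨⟨χ, hsm, hsupp⟩, Subtype.ext <| funext fun t => ?_⟩
  have := (hd t).deriv
  simp [this]

/-- The distributional solutions of a homogeneous first order equation are exponentials. -/
theorem exists_eq_integral_cexp {z : ℂ} {L : testFunctions →ₗ[ℂ] ℂ}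
    (hL : L ∘ₗ (-testDeriv - algebraMap ℂ _ z) = 0) :
    ∃ c : ℂ, ∀ φ, L φ = ∫ t, φ.1 t * (c * Complex.exp (z * t)) := by
  let ρ : ContDiffBump (0 : ℝ) := ⟨1, 2, by norm_num, by norm_num⟩
  have hρ : ∫ t, ((ρ t : ℝ) : ℂ) ≠ 0 := by
    rw [integral_complex_ofReal]
    exact_mod_cast (ρ.integral_pos (μ := volume)).ne'
  have hexp : ContDiff ℝ ∞ fun t : ℝ => Complex.exp (-z * t) :=
    (contDiff_const.mul Complex.ofRealCLM.contDiff).cexp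
  -- Its pairing with `exp (z t)` is `∫ ρ > 0`, so subtracting a multiple of `φ₀` makes any test
  -- function orthogonal to the exponential.
  let φ₀ : testFunctions := ⟨fun t => Complex.exp (-z * t) * (ρ t : ℝ),
    hexp.mul (Complex.ofRealCLM.contDiff.comp ρ.contDiff),
    HasCompactSupport.mul_left (ρ.hasCompactSupport.comp_left Complex.ofReal_zero)⟩
  set I := toDistribution _ (continuous_cexp_mul z).locallyIntegrable
  have hI : I φ₀ ≠ 0 := by
    convert hρ using 1
    refine integral_congr_ae (Eventually.of_forall fun t => ?_)
    show Complex.exp (-z * t) * (ρ t : ℝ) * Complex.exp (z * t) = (ρ t : ℝ)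
    linear_combination (ρ t : ℂ) * cexp_neg_mul_cexp z t
  refine ⟨L φ₀ / I φ₀, fun φ => ?_⟩
  obtain ⟨χ, hχ⟩ := exists_neg_deriv_sub_smul_eq (z := z) (ψ := φ - (I φ / I φ₀) • φ₀) (by
    change I (φ - (I φ / I φ₀) • φ₀) = 0
    rw [map_sub, map_smul, smul_eq_mul, div_mul_cancel₀ _ hI, sub_self])
  have h := LinearMap.congr_fun hL χ
  rw [LinearMap.comp_apply, hχ, map_sub, map_smul, smul_eq_mul, LinearMap.zero_apply,
    sub_eq_zero] at h
  have e : ∫ t, φ.1 t * (L φ₀ / I φ₀ * Complex.exp (z * t)) = L φ₀ / I φ₀ * I φ := by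
    refine Eq.trans ?_ (integral_const_mul _ _)
    exact integral_congr_ae (Eventually.of_forall fun t => by ring)
  rw [h, e]
  ring

theorem norm_cexp_mul (z : ℂ) (t : ℝ) : ‖Complex.exp (z * t)‖ = Real.exp (z.re * t) := by
  simp [Complex.norm_exp]

/-- The response of a stable first order system to a vanishing input vanishes. -/
theorem tendsto_cexp_mul_integral {f : ℝ → ℂ} (hf : Continuous f) (hf0 : Tendsto f atTop (𝓝 0))
    {z : ℂ} (hz : z.re < 0) :
    Tendsto (fun t : ℝ => Complex.exp (z * t) * ∫ s in (0 : ℝ)..t, Complex.exp (-z * s) * f s)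
      atTop (𝓝 0) := by
  have hc : Continuous fun s : ℝ => Complex.exp (-z * s) * f s :=
    (continuous_cexp_mul _).mul hf
  have hexp : Tendsto (fun t : ℝ => Real.exp (z.re * t)) atTop (𝓝 0) :=
    Real.tendsto_exp_atBot.comp (tendsto_id.const_mul_atTop_of_neg hz)
  rw [Metric.tendsto_atTop]
  intro ε hε
  -- Chosen so that `exp (-z.re * s) * δ` has the antiderivative `ε / 2 * exp (-z.re * s)`.
  set δ := ε / 2 * -z.re
  have hδ : 0 < δ := mul_pos (half_pos hε) (neg_pos.2 hz)
  obtain ⟨T, hT⟩ := Metric.tendsto_atTop.1 hf0 δ hδ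
  set A := ‖∫ s in (0 : ℝ)..T, Complex.exp (-z * s) * f s‖
  have hA : Tendsto (fun t : ℝ => Real.exp (z.re * t) * A) atTop (𝓝 0) := by
    simpa using hexp.mul_const A
  obtain ⟨T', hT'⟩ := Metric.tendsto_atTop.1 hA (ε / 2) (half_pos hε)
  refine ⟨max T T', fun t ht => ?_⟩
  have htT : T ≤ t := (le_max_left _ _).trans ht
  have h1 := hT' t ((le_max_right _ _).trans ht)
  rw [dist_zero_right, Real.norm_of_nonneg (by positivity)] at h1
  have hd : ∀ s, HasDerivAt (fun s : ℝ => ε / 2 * Real.exp (-z.re * s))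
      (Real.exp (-z.re * s) * δ) s := by
    intro s
    have := (((hasDerivAt_id s).const_mul (-z.re)).exp).const_mul (ε / 2)
    refine this.congr_deriv ?_
    simp only [id, δ]; ring
  have hcδ : Continuous fun s : ℝ => Real.exp (-z.re * s) * δ := by fun_prop
  have h2 : ‖∫ s in T..t, Complex.exp (-z * s) * f s‖ ≤ ε / 2 * Real.exp (-z.re * t) := by
    calc ‖∫ s in T..t, Complex.exp (-z * s) * f s‖
        ≤ ∫ s in T..t, Real.exp (-z.re * s) * δ := by
          refine intervalIntegral.norm_integral_le_of_norm_le htT ?_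
            (hcδ.intervalIntegrable _ _)
          refine Eventually.of_forall fun s hs => ?_
          rw [norm_mul, norm_cexp_mul, Complex.neg_re]
          have := hT s hs.1.le
          rw [dist_zero_right] at this
          gcongr
      _ = ε / 2 * Real.exp (-z.re * t) - ε / 2 * Real.exp (-z.re * T) :=
          intervalIntegral.integral_eq_sub_of_hasDerivAt (fun s _ => hd s)
            (hcδ.intervalIntegrable _ _)
      _ ≤ ε / 2 * Real.exp (-z.re * t) := sub_le_self _ (by positivity)
  rw [dist_zero_right, norm_mul, norm_cexp_mul,
    ← intervalIntegral.integral_add_adjacent_intervals (hc.intervalIntegrable 0 T)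
      (hc.intervalIntegrable T t)]
  calc Real.exp (z.re * t) * ‖_ + _‖
      ≤ Real.exp (z.re * t) * (A + ε / 2 * Real.exp (-z.re * t)) := by
        gcongr
        exact (norm_add_le _ _).trans (add_le_add_right h2 A)
    _ = Real.exp (z.re * t) * A + ε / 2 := by
        have : Real.exp (z.re * t) * Real.exp (-z.re * t) = 1 := by
          rw [← Real.exp_add]; simp
        linear_combination ε / 2 * this
    _ < ε := by linarith

/-- Integration by parts: a classical solution of `g' = z g + f` is a distributional one. -/
theorem integral_neg_deriv_sub_smul_mul {f g : ℝ → ℂ} (hf : Continuous f) {z : ℂ}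
    (hg : ∀ t, HasDerivAt g (z * g t + f t) t) (φ : testFunctions) :
    ∫ t, ((-testDeriv - algebraMap ℂ _ z) φ).1 t * g t = ∫ t, φ.1 t * f t := by
  have hgc : Continuous g := continuous_iff_continuousAt.2 fun t => (hg t).continuousAt
  have hd : ∀ t, HasDerivAt (fun t => φ.1 t * g t)
      (φ.1 t * f t - ((-testDeriv - algebraMap ℂ _ z) φ).1 t * g t) t := by
    intro t
    refine ((differentiable_testFunction φ t).hasDerivAt.mul (hg t)).congr_deriv ?_
    simp
    ring
  have i1 := integrable_mul_testFunction hf.locallyIntegrable φ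
  have i2 := integrable_mul_testFunction hgc.locallyIntegrable
    ((-testDeriv - algebraMap ℂ _ z) φ)
  have h := integral_eq_zero_of_hasDerivAt_of_integrable hd (i1.sub i2)
    (integrable_mul_testFunction hgc.locallyIntegrable φ)
  rw [integral_sub i1 i2, sub_eq_zero] at h
  exact h.symm

/-- Distributional solutions of a scalar equation with roots in the open left half plane are
continuous functions vanishing at infinity. -/
theorem exists_continuous_tendsto_zero_of_roots (S : Multiset ℂ) (hS : ∀ z ∈ S, z.re < 0)
    (T : testFunctions →ₗ[ℂ] ℂ)
    (hT : T ∘ₗ aeval (-testDeriv) (S.map fun z => X - C z).prod = 0) :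
    ∃ f : ℝ → ℂ, Continuous f ∧ Tendsto f atTop (𝓝 0) ∧ ∀ φ, T φ = ∫ t, φ.1 t * f t := by
  induction S using Multiset.induction_on generalizing T with
  | empty =>
    refine ⟨0, continuous_zero, tendsto_const_nhds, fun φ => ?_⟩
    simpa using LinearMap.congr_fun hT φ
  | cons z S ih =>
    have hz : z.re < 0 := hS z (Multiset.mem_cons_self z S)
    obtain ⟨f, hf, hf0, hTf⟩ := ih (fun w hw => hS w (Multiset.mem_cons_of_mem hw))
      (T ∘ₗ (-testDeriv - algebraMap ℂ _ z)) (by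
        rw [Multiset.map_cons, Multiset.prod_cons, map_mul, map_sub, aeval_X, aeval_C] at hT
        exact hT)
    have hg := hasDerivAt_cexp_mul_integral hf z 0
    have hg0 := tendsto_cexp_mul_integral hf hf0 hz
    set g := fun t : ℝ => Complex.exp (z * t) * ∫ s in (0 : ℝ)..t, Complex.exp (-z * s) * f s
    have hgc : Continuous g := continuous_iff_continuousAt.2 fun t => (hg t).continuousAt
    obtain ⟨c, hc⟩ := exists_eq_integral_cexp (z := z)
      (L := T - toDistribution g hgc.locallyIntegrable) (by
        ext φ
        have := hTf φ
        rw [LinearMap.comp_apply] at this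
        rw [LinearMap.comp_apply, LinearMap.sub_apply, this, toDistribution_apply,
          integral_neg_deriv_sub_smul_mul hf hg, sub_self, LinearMap.zero_apply])
    have hec : Continuous fun t : ℝ => c * Complex.exp (z * t) :=
      continuous_const.mul (continuous_cexp_mul z)
    refine ⟨fun t => c * Complex.exp (z * t) + g t, hec.add hgc, ?_, fun φ => ?_⟩
    · have : Tendsto (fun t : ℝ => Complex.exp (z * t)) atTop (𝓝 0) := by
        rw [tendsto_zero_iff_norm_tendsto_zero]
        simp only [norm_cexp_mul]
        exact Real.tendsto_exp_atBot.comp (tendsto_id.const_mul_atTop_of_neg hz)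
      simpa using (this.const_mul c).add hg0
    · have h := hc φ
      rw [LinearMap.sub_apply, toDistribution_apply, sub_eq_iff_eq_add] at h
      rw [h, ← integral_add (integrable_mul_testFunction hec.locallyIntegrable φ)
        (integrable_mul_testFunction hgc.locallyIntegrable φ)]
      exact integral_congr_ae (Eventually.of_forall fun t => by ring)

theorem exists_continuous_tendsto_zero {p : ℝ[X]} (hp : ∀ s : ℂ, 0 ≤ s.re → aeval s p ≠ 0)
    (T : testFunctions →ₗ[ℂ] ℂ) (hT : T ∘ₗ aeval (-testDeriv) p = 0) :
    ∃ f : ℝ → ℂ, Continuous f ∧ Tendsto f atTop (𝓝 0) ∧ ∀ φ, T φ = ∫ t, φ.1 t * f t := by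
  set q := p.map (algebraMap ℝ ℂ)
  have hq : q ≠ 0 := by
    intro h
    refine hp 0 le_rfl ?_
    rw [← aeval_map_algebraMap ℂ]
    change aeval 0 q = 0
    simp [h]
  have hfac : q = C q.leadingCoeff * (q.roots.map fun z => X - C z).prod :=
    Splits.eq_prod_roots (IsAlgClosed.splits q)
  refine exists_continuous_tendsto_zero_of_roots q.roots (fun z hz => ?_) T ?_
  · by_contra! h
    refine hp z h ?_
    rw [← eval_map_algebraMap]
    exact (mem_roots hq).1 hz
  · have h : T ∘ₗ aeval (-testDeriv) q = 0 := by rw [aeval_map_algebraMap]; exact hT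
    rw [hfac, map_mul, aeval_C] at h
    ext φ
    have := LinearMap.congr_fun h φ
    simpa [hq] using this

theorem ofReal_ae_eq_of_toDistribution_eq {w : ℝ → ℝ} (hw : LocallyIntegrable fun t => (w t : ℂ))
    {f : ℝ → ℂ} (hf : Continuous f)
    (h : ∀ φ : testFunctions, toDistribution _ hw φ = ∫ t, φ.1 t * f t) :
    (fun t => (w t : ℂ)) =ᵐ[volume] f :=
  ae_eq_of_integral_contDiff_smul_eq hw hf.locallyIntegrable fun φ h1 h2 => by
    simpa [ofRealTest, toDistribution_apply] using h (ofRealTest φ h1 h2)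

/-! ### Stability of systems with Hurwitz determinant -/

/-- A square system whose determinant is Hurwitz is asymptotically stable. -/
theorem asymptoticallyStable_of_det {κ : Type*} [Fintype κ] [DecidableEq κ] (R : Matrix κ κ ℝ[X])
    (hR : ∀ s : ℂ, 0 ≤ s.re → aeval s R.det ≠ 0) : AsymptoticallyStable R := by
  rintro w ⟨hw, hweak⟩
  have hwc : ∀ j, LocallyIntegrable fun t => (w t j : ℂ) := by
    intro j t
    obtain ⟨U, hU, hUw⟩ := hw t
    exact ⟨U, hU, (hUw.eval j).ofReal⟩
  have hT : ∀ i, ∑ j, toDistribution _ (hwc j) ∘ₗ aeval (-testDeriv) (R i j) = 0 := by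
    intro i
    refine eq_zero_of_ofRealTest fun φ h h' => ?_
    have := hweak φ h h' i
    simp only [LinearMap.sum_apply, LinearMap.comp_apply, toDistribution_aeval_ofRealTest]
    exact_mod_cast this
  rw [tendsto_pi_nhds]
  intro j
  obtain ⟨f, hf, hf0, hTf⟩ := exists_continuous_tendsto_zero hR _
    (comp_aeval_det_eq_zero R (-testDeriv) _ hT j)
  have hae := ofReal_ae_eq_of_toDistribution_eq (hwc j) hf hTf
  have hre : Tendsto (fun t => (f t).re) (atTop ⊓ ae volume) (𝓝 0) :=
    ((Complex.continuous_re.tendsto 0).comp hf0).mono_left inf_le_left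
  refine hre.congr' ((Filter.Eventually.filter_mono inf_le_right hae).mono fun t ht => ?_)
  simp [← ht]

end CyclicFeedback

theorem mainTheorem4 (n : ℕ) (hn : 1 ≤ n) (a b c d : ℝ) (hdet : a * d - b * c ≠ 0)
    (γ : Fin n → ℝ) (hγ : ∀ k, 0 < γ k)
    (h1 : CyclicFeedback.SecantInequality a b c d (CyclicFeedback.geomMean γ)
      (Real.cos (Real.pi / n)))
    (h2 : CyclicFeedback.SecantInequality a b c d (CyclicFeedback.geomMean γ)
      (Real.cos (Real.pi * (2 * (⌈(n : ℝ) / 2⌉ : ℝ) - 1) / n)))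
    (M N : Fin n → Polynomial ℝ)
    (hMN : ∀ (k : Fin n) (s : ℂ), 0 ≤ s.re →
      (Polynomial.aeval s (N k) ≠ 0 ∨ Polynomial.aeval s (M k) ≠ 0) ∧
      CyclicFeedback.extQuot (Polynomial.aeval s (N k)) (Polynomial.aeval s (M k)) ∈
        CyclicFeedback.mobiusDisk a b c d (γ k)) :
    CyclicFeedback.AsymptoticallyStable (CyclicFeedback.interconnection N M) := by
  exact CyclicFeedback.asymptoticallyStable_of_det _ fun s hs =>
    CyclicFeedback.aeval_det_interconnection_ne_zero hn hγ h1 h2 fun k => hMN k s hs
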